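/- There is a constant $C$ such that for every regular language $L$ over a one-letter alphabet, \[ \mathrm{nsyn}(L)\;\le\; C\cdot \mathrm{ns}(L)^2 . \] Here, for a regular language $L\subseteq\Sigma^*$: * $\mathrm{ns}(L)$, the nondeterministic state complexity, is the least number of states of a nondeterministic finite automaton (possibly with several initial states, without $\varepsilon$-transitions) accepting $L$. * A semilattice is a join-semilattice with a least element; its morphisms preserve finite joins, including the least element. A boolean representation of a monoid $M$ is a finite semilattice $S$ with a monoid morphism $\rho\colon M\to \mathrm{End}(S)$, where $\rho(mn)$ is $\rho(m)$ followed by $\rho(n)$; its degree is the number of join-irreducible elements of $S$. A representation $\rho_2$ on $S_2$ extends a representation $\rho_1$ on $S_1$ if there is an injective semilattice morphism $f\colon S_1\to S_2$ with $f(\rho_1(m)(s))=\rho_2(m)(f(s))$ for all $m\in M$, $s\in S_1$. * The syntactic monoid $\mathrm{Syn}(L)$ is the quotient of $\Sigma^*$ by the congruence $v\equiv_L w$ iff for all $x,y\in\Sigma^*$: $xvy\in L\Leftrightarrow xwy\in L$. For a word $w$ and a language $K$, put $w^{-1}K=\{u : wu\in K\}$. The canonical boolean representation of $\mathrm{Syn}(L)$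 acts on the semilattice of all finite unions of left derivatives $w^{-1}L$ (ordered by inclusion) by $[w]_L\mapsto (K\mapsto w^{-1}K)$. * $\mathrm{nsyn}(L)$, the nondeterministic syntactic complexity, is the least degree of a boolean representation of $\mathrm{Syn}(L)$ extending the canonical one. -/

import Mathlib

universe u

namespace NSyn

section Representations

/-- A boolean representation of a monoid `M` on a join-semilattice `S` with least element:
a monoid morphism from `M` to the endomorphisms of `S` (maps preserving `⊥` and `⊔`), where
endomorphisms are multiplied in diagrammatic order, so that `m * n` acts by first applying `m`
and then `n` (as the derivatives `K ↦ w⁻¹K` do). Finiteness of `S` is required separately. -/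
structure BooleanRep (M : Type*) [Monoid M] (S : Type*) [SemilatticeSup S] [OrderBot S] where
  act : M → SupBotHom S S
  act_one : act 1 = SupBotHom.id S
  act_mul : ∀ m n : M, act (m * n) = (act n).comp (act m)

/-- The degree of a representation on `S`: the number of join-irreducible elements of `S`. -/
noncomputable def BooleanRep.degree {M : Type*} [Monoid M] {S : Type*} [SemilatticeSup S]
    [OrderBot S] (_ρ : BooleanRep M S) : ℕ :=
  Nat.card {s : S // SupIrred s}

/-- `ρ₂` extends `ρ₁`: there is an injective equivariant semilattice morphism from `ρ₁` to `ρ₂`. -/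
def BooleanRep.Extends {M : Type*} [Monoid M] {S₁ S₂ : Type*}
    [SemilatticeSup S₁] [OrderBot S₁] [SemilatticeSup S₂] [OrderBot S₂]
    (ρ₂ : BooleanRep M S₂) (ρ₁ : BooleanRep M S₁) : Prop :=
  ∃ f : SupBotHom S₁ S₂, Function.Injective f ∧
    ∀ (m : M) (s : S₁), f (ρ₁.act m s) = ρ₂.act m (f s)

end Representations

section Languages

variable {α : Type u}

/-- The syntactic congruence of `L` on the free monoid. -/
def syntacticCon (L : Language α) : Con (FreeMonoid α) where
  r v w := ∀ x y : FreeMonoid α, (x * v * y).toList ∈ L ↔ (x * w * y).toList ∈ L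
  iseqv :=
    { refl := fun _ _ _ => Iff.rfl
      symm := fun h x y => (h x y).symm
      trans := fun h₁ h₂ x y => (h₁ x y).trans (h₂ x y) }
  mul' := by
    intro a b c d h₁ h₂ x y
    have e₁ := h₁ x (c * y)
    have e₂ := h₂ (x * b) y
    simp only [mul_assoc] at e₁ e₂ ⊢
    exact e₁.trans e₂

/-- The syntactic monoid of `L`. -/
abbrev Syn (L : Language α) : Type u := (syntacticCon L).Quotient

/-- The finite unions of left derivatives of `L`. -/
def leftDerivativeUnions (L : Language α) : Set (Language α) :=
  {K | ∃ F : Finset (List α), K = F.sup L.leftQuotient}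

/-- The semilattice of finite unions of left derivatives of `L`, ordered by inclusion. -/
abbrev LQ (L : Language α) : Type u := leftDerivativeUnions L

theorem sup_mem_leftDerivativeUnions (L : Language α) ⦃K₁ K₂ : Language α⦄
    (h₁ : K₁ ∈ leftDerivativeUnions L) (h₂ : K₂ ∈ leftDerivativeUnions L) :
    K₁ ⊔ K₂ ∈ leftDerivativeUnions L := by
  classical
  obtain ⟨F₁, rfl⟩ := h₁
  obtain ⟨F₂, rfl⟩ := h₂
  exact ⟨F₁ ∪ F₂, Finset.sup_union.symm⟩

theorem bot_mem_leftDerivativeUnions (L : Language α) :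
    (⊥ : Language α) ∈ leftDerivativeUnions L :=
  ⟨∅, Finset.sup_empty.symm⟩

instance (L : Language α) : SemilatticeSup (LQ L) :=
  Subtype.semilatticeSup (sup_mem_leftDerivativeUnions L)

instance (L : Language α) : OrderBot (LQ L) :=
  Subtype.orderBot (bot_mem_leftDerivativeUnions L)

theorem leftQuotient_sup (K₁ K₂ : Language α) (w : List α) :
    (K₁ ⊔ K₂).leftQuotient w = K₁.leftQuotient w ⊔ K₂.leftQuotient w := rfl

theorem leftQuotient_bot (w : List α) : (⊥ : Language α).leftQuotient w = ⊥ := rfl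

theorem leftQuotient_mem_leftDerivativeUnions (L : Language α) (w : List α) ⦃K : Language α⦄
    (h : K ∈ leftDerivativeUnions L) : K.leftQuotient w ∈ leftDerivativeUnions L := by
  classical
  obtain ⟨F, rfl⟩ := h
  refine ⟨F.image (· ++ w), ?_⟩
  rw [Finset.sup_image, Finset.apply_sup_eq_sup_comp (fun K : Language α => K.leftQuotient w)
    (fun K₁ K₂ => leftQuotient_sup K₁ K₂ w) (leftQuotient_bot w)]
  refine Finset.sup_congr rfl fun v _ => ?_
  simp only [Function.comp, Language.leftQuotient_append]

/-- The endomorphism `K ↦ w⁻¹K` of the semilattice `LQ L`. -/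
def leftQuotientHom (L : Language α) (w : List α) : SupBotHom (LQ L) (LQ L) where
  toFun K := ⟨K.1.leftQuotient w, leftQuotient_mem_leftDerivativeUnions L w K.2⟩
  map_sup' _ _ := Subtype.ext rfl
  map_bot' := Subtype.ext rfl

theorem leftQuotientHom_eq_of_syntacticCon (L : Language α) {v w : FreeMonoid α}
    (h : syntacticCon L v w) : leftQuotientHom L v.toList = leftQuotientHom L w.toList := by
  refine DFunLike.ext _ _ fun K => Subtype.ext ?_
  obtain ⟨_, F, rfl⟩ := K
  change Language.leftQuotient (F.sup L.leftQuotient) v.toList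
    = Language.leftQuotient (F.sup L.leftQuotient) w.toList
  have key : ∀ z : List α, (F.sup L.leftQuotient).leftQuotient z
      = F.sup (fun u => (L.leftQuotient u).leftQuotient z) := fun z =>
    Finset.apply_sup_eq_sup_comp (fun K : Language α => K.leftQuotient z)
      (fun K₁ K₂ => leftQuotient_sup K₁ K₂ z) (leftQuotient_bot z)
  rw [key, key]
  refine Finset.sup_congr rfl fun u _ => ?_
  ext y
  have := h (FreeMonoid.ofList u) (FreeMonoid.ofList y)
  simpa [Language.mem_leftQuotient] using this

/-- The canonical boolean representation `[w] ↦ (K ↦ w⁻¹K)` of the syntactic monoid of `L`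
on the semilattice of finite unions of left derivatives of `L`. -/
def canonicalRep (L : Language α) : BooleanRep (Syn L) (LQ L) where
  act m := Quotient.liftOn m (fun w : FreeMonoid α => leftQuotientHom L w.toList)
    fun _ _ h => leftQuotientHom_eq_of_syntacticCon L h
  act_one := rfl
  act_mul m n := by
    induction m, n using Con.induction_on₂ with
    | H v w =>
      refine DFunLike.ext _ _ fun K => Subtype.ext ?_
      exact Language.leftQuotient_append K.1 v.toList w.toList

/-- The degrees of boolean representations of the syntactic monoid of `L`, on finite
semilattices, that extend the canonical one. -/
def extensionDegrees (L : Language α) : Set ℕ :=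
  {k | ∃ (S : Type u) (_ : SemilatticeSup S) (_ : OrderBot S) (_ : Finite S)
    (ρ : BooleanRep (Syn L) S), ρ.Extends (canonicalRep L) ∧ ρ.degree = k}

/-- The nondeterministic syntactic complexity of `L`. -/
noncomputable def nsyn (L : Language α) : ℕ := sInf (extensionDegrees L)

/-- The numbers of states of nondeterministic finite automata accepting `L`
(several initial states are allowed, and there are no silent transitions). -/
def nfaSizes (L : Language α) : Set ℕ :=
  {n | ∃ (σ : Type) (_ : Fintype σ) (M : NFA α σ), M.accepts = L ∧ Fintype.card σ = n}

/-- The nondeterministic state complexity of `L`. -/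
noncomputable def ns (L : Language α) : ℕ := sInf (nfaSizes L)

/-! For regular languages both minima are attained. -/

theorem finite_LQ {L : Language α} (hL : L.IsRegular) : Finite (LQ L) := by
  classical
  have hfin := hL.finite_range_leftQuotient
  refine Set.Finite.to_subtype
    ((hfin.toFinset.powerset.image (fun G => G.sup id)).finite_toSet.subset ?_)
  rintro K ⟨F, rfl⟩
  simp only [Finset.coe_image, Set.mem_image, Finset.mem_coe, Finset.mem_powerset]
  refine ⟨F.image L.leftQuotient, ?_, ?_⟩
  · intro K hK
    obtain ⟨w, _, rfl⟩ := Finset.mem_image.1 hK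
    simp
  · rw [Finset.sup_image]; rfl

theorem nsyn_mem_extensionDegrees {L : Language α} (hL : L.IsRegular) :
    nsyn L ∈ extensionDegrees L :=
  Nat.sInf_mem ⟨_, LQ L, inferInstance, inferInstance, finite_LQ hL, canonicalRep L,
    ⟨SupBotHom.id _, Function.injective_id, fun _ _ => rfl⟩, rfl⟩

theorem ns_mem_nfaSizes {L : Language α} (hL : L.IsRegular) : ns L ∈ nfaSizes L := by
  obtain ⟨σ, _, M, hM⟩ := hL
  exact Nat.sInf_mem ⟨_, σ, inferInstance, M.toNFA, by rw [DFA.toNFA_correct, hM], rfl⟩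

end Languages

end NSyn

/-!
Let `n = ns L`, and identify words over the one-letter alphabet with their lengths. The degree of
a representation is at most the number of generators of its semilattice. It is therefore enough
(`nsyn_le_card`) to find `3 * n ^ 2` languages whose finite unions include `L` and are closed under
left derivatives, and on each of which syntactically congruent words have the same derivative.

The generators come from a weak form of Chrobak's normal form (`exists_modulus_of_mem_accepts`):
beyond `2 * n ^ 2`, the language `L` is a union of residue classes modulo numbers `d ≤ n`. Indeed, a
long accepting walk passes through a state `q` on a closed walk of some length `d ≤ n`. By the
pigeonhole principle on pairs (state, residue modulo `d`), its parts before and after `q` can be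
shortened to at most `n * d` without changing their lengths modulo `d`; the closed walk at `q` then
realizes all large lengths in the same residue class.

A residue class modulo `d` need not respect the syntactic congruence, because `d` need not divide
the period of `L`. It is replaced by its saturation `congClass L d r`, the class modulo the subgroup
generated by `d` and the differences of lengths of congruent words. Beyond `2 * n ^ 2` a saturated
class still lies in `L` if the original one does (`mem_of_mem_congClass`). The derivatives of `L` by
words shorter than `2 * n ^ 2` and the at most `n ^ 2` classes `congClass L d r` are the generators.
-/

namespace NSyn

/-! ### Representations generated by finitely many languages -/

section Joins

variable {α : Type u} {ι : Type*}

/-- The finite unions of languages of the family `g`, including the empty union. -/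
def joins (g : ι → Language α) : Set (Language α) :=
  {K | ∃ F : Finset ι, K = F.sup g}

theorem sup_mem_joins (g : ι → Language α) ⦃K₁ K₂ : Language α⦄
    (h₁ : K₁ ∈ joins g) (h₂ : K₂ ∈ joins g) : K₁ ⊔ K₂ ∈ joins g := by
  classical
  obtain ⟨F₁, rfl⟩ := h₁
  obtain ⟨F₂, rfl⟩ := h₂
  exact ⟨F₁ ∪ F₂, Finset.sup_union.symm⟩

theorem bot_mem_joins (g : ι → Language α) : (⊥ : Language α) ∈ joins g :=
  ⟨∅, Finset.sup_empty.symm⟩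

theorem mem_joins (g : ι → Language α) (i : ι) : g i ∈ joins g :=
  ⟨{i}, Finset.sup_singleton.symm⟩

theorem finset_sup_mem_joins (g : ι → Language α) {κ : Type*} (F : Finset κ)
    (f : κ → Language α) (h : ∀ k ∈ F, f k ∈ joins g) : F.sup f ∈ joins g :=
  Finset.sup_induction (bot_mem_joins g) (fun _ h₁ _ h₂ => sup_mem_joins g h₁ h₂) h

instance (g : ι → Language α) : SemilatticeSup (joins g) :=
  Subtype.semilatticeSup (sup_mem_joins g)

instance (g : ι → Language α) : OrderBot (joins g) :=
  Subtype.orderBot (bot_mem_joins g)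

instance finite_joins [Finite ι] (g : ι → Language α) : Finite (joins g) := by
  classical
  have := Fintype.ofFinite ι
  exact ((Set.finite_range fun F : Finset ι => F.sup g).subset
    (by rintro K ⟨F, rfl⟩; exact ⟨F, rfl⟩)).to_subtype

theorem leftQuotient_finset_sup {κ : Type*} (F : Finset κ) (f : κ → Language α) (w : List α) :
    (F.sup f).leftQuotient w = F.sup fun k => (f k).leftQuotient w :=
  Finset.apply_sup_eq_sup_comp (fun K : Language α => K.leftQuotient w)
    (fun K₁ K₂ => leftQuotient_sup K₁ K₂ w) (leftQuotient_bot w)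

theorem leftQuotient_mem_joins {g : ι → Language α}
    (hg : ∀ i w, (g i).leftQuotient w ∈ joins g) {K : Language α} (hK : K ∈ joins g)
    (w : List α) : K.leftQuotient w ∈ joins g := by
  obtain ⟨F, rfl⟩ := hK
  rw [leftQuotient_finset_sup]
  exact finset_sup_mem_joins g F _ fun i _ => hg i w

theorem leftQuotient_eq_of_mem_joins {g : ι → Language α} {v w : List α}
    (h : ∀ i, (g i).leftQuotient v = (g i).leftQuotient w) {K : Language α} (hK : K ∈ joins g) :
    K.leftQuotient v = K.leftQuotient w := by
  obtain ⟨F, rfl⟩ := hK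
  rw [leftQuotient_finset_sup, leftQuotient_finset_sup]
  exact Finset.sup_congr rfl fun i _ => h i

/-- The action of the syntactic monoid of `L` by left derivatives on the finite unions of a family
of languages closed under derivatives and compatible with the syntactic congruence. -/
def joinsRep (L : Language α) (g : ι → Language α)
    (hg : ∀ i w, (g i).leftQuotient w ∈ joins g)
    (hc : ∀ i (v w : FreeMonoid α), syntacticCon L v w →
      (g i).leftQuotient v.toList = (g i).leftQuotient w.toList) :
    BooleanRep (Syn L) (joins g) where
  act m := Quotient.liftOn m
    (fun w : FreeMonoid α =>
      { toFun := fun K => ⟨K.1.leftQuotient w.toList, leftQuotient_mem_joins hg K.2 w.toList⟩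
        map_sup' := fun _ _ => Subtype.ext rfl
        map_bot' := Subtype.ext rfl })
    fun v w h => DFunLike.ext _ _ fun K => Subtype.ext <|
      leftQuotient_eq_of_mem_joins (fun i => hc i v w h) K.2
  act_one := rfl
  act_mul m n := by
    induction m, n using Con.induction_on₂ with
    | H v w =>
      exact DFunLike.ext _ _ fun K => Subtype.ext <|
        Language.leftQuotient_append K.1 v.toList w.toList

theorem joinsRep_extends (L : Language α) (g : ι → Language α) (hL : L ∈ joins g)
    (hg : ∀ i w, (g i).leftQuotient w ∈ joins g)
    (hc : ∀ i (v w : FreeMonoid α), syntacticCon L v w →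
      (g i).leftQuotient v.toList = (g i).leftQuotient w.toList) :
    (joinsRep L g hg hc).Extends (canonicalRep L) := by
  have hmem : ∀ K ∈ leftDerivativeUnions L, K ∈ joins g := by
    rintro K ⟨F, rfl⟩
    exact finset_sup_mem_joins g F _ fun w _ => leftQuotient_mem_joins hg hL w
  refine ⟨{ toFun := fun K => ⟨K.1, hmem K.1 K.2⟩
            map_sup' := fun _ _ => Subtype.ext rfl
            map_bot' := Subtype.ext rfl }, ?_, ?_⟩
  · intro K₁ K₂ h
    exact Subtype.ext (congrArg (fun K : joins g => K.1) h)
  · intro m K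
    induction m using Con.induction_on with
    | H w => exact Subtype.ext rfl

theorem card_supIrred_joins_le [Fintype ι] (g : ι → Language α) :
    Nat.card {K : joins g // SupIrred K} ≤ Fintype.card ι := by
  -- A join-irreducible element equals one of the generators it is a union of.
  have key : ∀ K : {K : joins g // SupIrred K}, ∃ i, g i = K.1.1 := by
    rintro ⟨⟨_, F, rfl⟩, hK⟩
    have hsup : F.sup (fun i => (⟨g i, mem_joins g i⟩ : joins g)) = ⟨F.sup g, F, rfl⟩ := by
      refine Subtype.ext ?_
      exact Finset.apply_sup_eq_sup_comp (fun K : joins g => K.1) (fun _ _ => rfl) rfl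
    obtain ⟨i, -, hi⟩ := hK.finset_sup_eq hsup
    exact ⟨i, congrArg Subtype.val hi⟩
  choose f hf using key
  rw [← Nat.card_eq_fintype_card]
  refine Nat.card_le_card_of_injective f fun K₁ K₂ h => Subtype.ext (Subtype.ext ?_)
  rw [← hf K₁, ← hf K₂, h]

/-- A family of languages that generates `L`, is closed under derivatives up to finite unions and
respects the syntactic congruence bounds `nsyn L` by its size. -/
theorem nsyn_le_card [Fintype ι] (L : Language α) (g : ι → Language α) (hL : L ∈ joins g)
    (hg : ∀ i w, (g i).leftQuotient w ∈ joins g)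
    (hc : ∀ i (v w : FreeMonoid α), syntacticCon L v w →
      (g i).leftQuotient v.toList = (g i).leftQuotient w.toList) :
    nsyn L ≤ Fintype.card ι :=
  have hmem : (joinsRep L g hg hc).degree ∈ extensionDegrees L :=
    ⟨joins g, inferInstance, inferInstance, inferInstance, joinsRep L g hg hc,
      joinsRep_extends L g hL hg hc, rfl⟩
  (Nat.sInf_le hmem).trans (card_supIrred_joins_le g)

end Joins

/-! ### Walks -/

section Walks

variable {σ : Type*} {R : σ → σ → Prop}

/-- `IsWalk R k s t`: some walk with `k` steps leads from `s` to `t` in the digraph `R`. -/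
def IsWalk (R : σ → σ → Prop) : ℕ → σ → σ → Prop
  | 0, s, t => s = t
  | k + 1, s, t => ∃ u, R s u ∧ IsWalk R k u t

theorem isWalk_add {a b : ℕ} {s t : σ} :
    IsWalk R (a + b) s t ↔ ∃ u, IsWalk R a s u ∧ IsWalk R b u t := by
  induction a generalizing s with
  | zero => simp [IsWalk]
  | succ a ih =>
    rw [Nat.add_right_comm]
    simp only [IsWalk, ih]
    grind

theorem IsWalk.trans {a b : ℕ} {s t u : σ} (h₁ : IsWalk R a s t) (h₂ : IsWalk R b t u) :
    IsWalk R (a + b) s u :=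
  isWalk_add.2 ⟨t, h₁, h₂⟩

theorem IsWalk.mul_left {d : ℕ} {q : σ} (h : IsWalk R d q q) (k : ℕ) : IsWalk R (k * d) q q := by
  induction k with
  | zero => simp [IsWalk]
  | succ k ih => rw [Nat.succ_mul]; exact ih.trans h

/-- Pigeonhole principle for walks whose vertices carry a colour that depends on their position:
among the first `m + 1` positions, two share both vertex and colour. -/
theorem IsWalk.exists_repeat [Fintype σ] {κ : Type*} [Fintype κ] (c : ℕ → κ) {k m : ℕ}
    {s t : σ} (h : IsWalk R k s t) (hm : m ≤ k) (hcard : Fintype.card σ * Fintype.card κ ≤ m) :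
    ∃ i j q, i < j ∧ j ≤ m ∧ c i = c j ∧
      IsWalk R i s q ∧ IsWalk R (j - i) q q ∧ IsWalk R (k - j) q t := by
  -- `f i` is the vertex at position `i`.
  obtain ⟨f, hf⟩ : ∃ f : ℕ → σ, ∀ i ≤ k, IsWalk R i s (f i) ∧
      ∀ j, i ≤ j → j ≤ k → IsWalk R (j - i) (f i) (f j) ∧ IsWalk R (k - j) (f j) t := by
    clear hm
    induction k generalizing s with
    | zero =>
      refine ⟨fun _ => s, fun i hi => ?_⟩
      obtain rfl := Nat.le_zero.1 hi
      refine ⟨rfl, fun j _ hj => ?_⟩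
      obtain rfl := Nat.le_zero.1 hj
      exact ⟨rfl, h⟩
    | succ k ih =>
      obtain ⟨u, hu, h'⟩ := h
      obtain ⟨f, hf⟩ := ih h'
      refine ⟨fun i => Nat.casesOn i s f, fun i hi => ?_⟩
      rcases i with _ | i
      · refine ⟨rfl, fun j _ hj => ?_⟩
        rcases j with _ | j
        · exact ⟨rfl, u, hu, h'⟩
        · have hj' : j ≤ k := by omega
          refine ⟨⟨u, hu, (hf j hj').1⟩, ?_⟩
          rw [Nat.add_sub_add_right]
          exact ((hf j hj').2 j le_rfl hj').2
      · have hi' : i ≤ k := by omega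
        refine ⟨⟨u, hu, (hf i hi').1⟩, fun j hij hj => ?_⟩
        rcases j with _ | j
        · omega
        · rw [Nat.add_sub_add_right, Nat.add_sub_add_right]
          exact (hf i hi').2 j (by omega) (by omega)
  obtain ⟨a, b, hab, heq⟩ := Fintype.exists_ne_map_eq_of_card_lt
    (fun i : Fin (m + 1) => (f i, c i)) (by rw [Fintype.card_prod, Fintype.card_fin]; omega)
  wlog hlt : a < b generalizing a b
  · exact this b a hab.symm heq.symm (lt_of_le_of_ne (not_lt.1 hlt) hab.symm)
  obtain ⟨hfab, hcab⟩ := Prod.mk.inj heq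
  have hlt' : (a : ℕ) < b := hlt
  have hwalk := (hf a (by omega)).2 b hlt'.le (by omega)
  rw [← hfab] at hwalk
  exact ⟨a, b, f a, hlt', by omega, hcab, (hf a (by omega)).1, hwalk⟩

/-- Cutting out closed subwalks of length divisible by `d` shortens a walk while keeping its ends
and its length modulo `d`. -/
theorem IsWalk.exists_short [Fintype σ] {k d : ℕ} (hd : 0 < d) {s t : σ} (h : IsWalk R k s t) :
    ∃ k', k' ≤ Fintype.card σ * d ∧ k' ≡ k [MOD d] ∧ IsWalk R k' s t := by
  induction k using Nat.strong_induction_on with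
  | _ k ih =>
    by_cases hk : k ≤ Fintype.card σ * d
    · exact ⟨k, hk, rfl, h⟩
    have : NeZero d := ⟨hd.ne'⟩
    obtain ⟨i, j, q, hij, hj, hc, h₁, -, h₂⟩ :=
      h.exists_repeat (fun i => (i : ZMod d)) le_rfl (by rw [ZMod.card]; omega)
    obtain ⟨k', hk', hmod, hw⟩ := ih (i + (k - j)) (by omega) (h₁.trans h₂)
    refine ⟨k', hk', hmod.trans ?_, hw⟩
    rw [ZMod.natCast_eq_natCast_iff] at hc
    simpa [Nat.add_sub_cancel' hj] using hc.add_right (k - j)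

end Walks

/-! ### Residue classes saturated by the syntactic congruence -/

section CongClass

variable {α : Type u}

/-- The words congruent in length to `r` modulo the subgroup generated by `d` and the differences
of lengths of syntactically congruent words. Since the syntactic congruence is a congruence, every
element of this subgroup is a multiple of `d` plus a single such difference. -/
def congClass (L : Language α) (d r : ℕ) : Language α :=
  {u | ∃ v w : FreeMonoid α, syntacticCon L v w ∧
    u.length + v.toList.length ≡ r + w.toList.length [MOD d]}

theorem mem_congClass {L : Language α} {d r : ℕ} {u : List α} :
    u ∈ congClass L d r ↔ ∃ v w : FreeMonoid α, syntacticCon L v w ∧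
      u.length + v.toList.length ≡ r + w.toList.length [MOD d] := Iff.rfl

theorem leftQuotient_congClass (L : Language α) {d : ℕ} (hd : 0 < d) (r : ℕ) (w : List α) :
    ∃ r' < d, (congClass L d r).leftQuotient w = congClass L d r' := by
  -- `r'` represents the class of `r - w.length`.
  refine ⟨(r + w.length * (d - 1)) % d, Nat.mod_lt _ hd, ?_⟩
  have hr : (r + w.length * (d - 1)) % d + w.length ≡ r [MOD d] := by
    refine ((Nat.mod_modEq _ d).add_right _).trans ?_
    obtain ⟨e, rfl⟩ : ∃ e, d = e + 1 := ⟨d - 1, by omega⟩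
    have : r + w.length * (e + 1 - 1) + w.length = r + w.length * (e + 1) := by
      rw [Nat.add_sub_cancel]; ring
    rw [this]
    simp [Nat.ModEq]
  ext u
  rw [Language.mem_leftQuotient, mem_congClass, mem_congClass]
  refine exists₂_congr fun v v' => and_congr_right fun _ => ?_
  rw [List.length_append]
  constructor
  · intro h
    refine Nat.ModEq.add_right_cancel' w.length ?_
    calc u.length + v.toList.length + w.length = w.length + u.length + v.toList.length := by ring
      _ ≡ r + v'.toList.length [MOD d] := h
      _ ≡ (r + w.length * (d - 1)) % d + w.length + v'.toList.length [MOD d] :=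
        hr.symm.add_right _
      _ = (r + w.length * (d - 1)) % d + v'.toList.length + w.length := by ring
  · intro h
    calc w.length + u.length + v.toList.length = u.length + v.toList.length + w.length := by ring
      _ ≡ (r + w.length * (d - 1)) % d + v'.toList.length + w.length [MOD d] := h.add_right _
      _ = (r + w.length * (d - 1)) % d + w.length + v'.toList.length := by ring
      _ ≡ r + v'.toList.length [MOD d] := hr.add_right _

theorem leftQuotient_congClass_le (L : Language α) (d r : ℕ) {v w : FreeMonoid α}
    (h : syntacticCon L v w) :
    (congClass L d r).leftQuotient v.toList ≤ (congClass L d r).leftQuotient w.toList := by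
  intro u hu
  obtain ⟨a, b, hab, hmod⟩ := hu
  refine ⟨v * a, w * b, (syntacticCon L).mul h hab, ?_⟩
  simp only [List.length_append, FreeMonoid.toList_mul] at hmod ⊢
  calc w.toList.length + u.length + (v.toList.length + a.toList.length)
      = w.toList.length + (v.toList.length + u.length + a.toList.length) := by ring
    _ ≡ w.toList.length + (r + b.toList.length) [MOD d] := hmod.add_left _
    _ = r + (w.toList.length + b.toList.length) := by ring

theorem leftQuotient_congClass_congr (L : Language α) (d r : ℕ) {v w : FreeMonoid α}
    (h : syntacticCon L v w) :
    (congClass L d r).leftQuotient v.toList = (congClass L d r).leftQuotient w.toList :=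
  le_antisymm (leftQuotient_congClass_le L d r h)
    (leftQuotient_congClass_le L d r ((syntacticCon L).symm h))

theorem leftQuotient_congr (L : Language α) {v w : FreeMonoid α} (h : syntacticCon L v w) :
    L.leftQuotient v.toList = L.leftQuotient w.toList := by
  ext u
  simpa [Language.mem_leftQuotient] using h 1 (FreeMonoid.ofList u)

end CongClass

/-! ### Unary automata -/

section Unary

variable {α : Type u} [Unique α]

theorem mem_accepts_iff_exists_isWalk {σ : Type*} (M : NFA α σ) (x : List α) :
    x ∈ M.accepts ↔ ∃ s ∈ M.start, ∃ t ∈ M.accept,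
      IsWalk (fun s t => t ∈ M.step s default) x.length s t := by
  have key : ∀ S t, t ∈ M.evalFrom S x ↔
      ∃ s ∈ S, IsWalk (fun s t => t ∈ M.step s default) x.length s t := by
    induction x with
    | nil => simp [IsWalk]
    | cons a x ih =>
      intro S t
      rw [NFA.evalFrom_cons, ih, Unique.eq_default a]
      simp only [NFA.mem_stepSet, List.length_cons, IsWalk]
      grind
  rw [NFA.mem_accepts]
  simp only [key]
  grind

/-- Beyond `2 * n ^ 2`, a unary language accepted by an automaton with `n` states is a union of
residue classes modulo positive numbers up to `n`. -/
theorem exists_modulus_of_mem_accepts {σ : Type*} [Fintype σ] (M : NFA α σ) {x : List α}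
    (hx : x ∈ M.accepts) (hlen : 2 * Fintype.card σ ^ 2 ≤ x.length) :
    ∃ d, 0 < d ∧ d ≤ Fintype.card σ ∧ ∀ y : List α, 2 * Fintype.card σ ^ 2 ≤ y.length →
      y.length ≡ x.length [MOD d] → y ∈ M.accepts := by
  obtain ⟨s, hs, t, ht, hw⟩ := (mem_accepts_iff_exists_isWalk M x).1 hx
  set n := Fintype.card σ
  have hn : n ≤ 2 * n ^ 2 := by nlinarith [Nat.le_self_pow two_ne_zero n]
  obtain ⟨i, j, q, hij, hj, -, h₁, hq, h₂⟩ :=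
    hw.exists_repeat (fun _ => ()) (hn.trans hlen) (by simp [n])
  have hd : 0 < j - i := by omega
  obtain ⟨a, ha, hamod, hwa⟩ := h₁.exists_short hd
  obtain ⟨b, hb, hbmod, hwb⟩ := h₂.exists_short hd
  refine ⟨j - i, hd, by omega, fun y hy hymod => ?_⟩
  have hab : a + b ≤ y.length := by
    have : n * (j - i) ≤ n * n := Nat.mul_le_mul_left n (by omega)
    nlinarith
  have hmod : a + b ≡ y.length [MOD j - i] := by
    -- Removing the closed walk at `q` changes the length `x.length` by `j - i`.
    have hcut : x.length = i + (x.length - j) + (j - i) := by omega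
    have hx' : i + (x.length - j) ≡ x.length [MOD j - i] := by
      conv_rhs => rw [hcut]
      simp [Nat.ModEq]
    exact (hamod.add hbmod).trans (hx'.trans hymod.symm)
  obtain ⟨c, hc⟩ := (Nat.modEq_iff_dvd' hab).1 hmod
  refine (mem_accepts_iff_exists_isWalk M y).2 ⟨s, hs, t, ht, ?_⟩
  have hlen : y.length = a + (c * (j - i) + b) := by rw [mul_comm c]; omega
  rw [hlen]
  exact hwa.trans ((hq.mul_left c).trans hwb)

/-! ### Generators of a small extension of the canonical representation -/

theorem eq_of_length_eq {x y : List α} (h : x.length = y.length) : x = y :=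
  List.ext_getElem h fun _ _ _ => Subsingleton.elim _ _

/-- If every word of `L` of length at least `N` carries its whole residue class modulo some positive
`d ≤ n` into `L` from `N` on, then it even carries the saturated class of that residue class. -/
theorem mem_of_mem_congClass {L : Language α} {N n : ℕ}
    (hL : ∀ x ∈ L, N ≤ x.length → ∃ d, 0 < d ∧ d ≤ n ∧
      ∀ y : List α, N ≤ y.length → y.length ≡ x.length [MOD d] → y ∈ L)
    {d ℓ : ℕ} (hd : ∀ y : List α, N ≤ y.length → y.length ≡ ℓ [MOD d] → y ∈ L)
    (hdn : d ∣ n.factorial) {y : List α} (hy : N ≤ y.length) (hmem : y ∈ congClass L d ℓ) :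
    y ∈ L := by
  obtain ⟨v, w, hvw, hmod⟩ := hmem
  -- `n !` is a period of `L` from `N` on, so `y` may be lengthened to a word ending in `w`.
  set e := (N + w.toList.length) * n.factorial
  have hle : N + w.toList.length ≤ e := Nat.le_mul_of_pos_right _ n.factorial_pos
  let z : List α := List.replicate (y.length + e - w.toList.length) default
  have hz : z.length = y.length + e - w.toList.length := List.length_replicate ..
  have hzv : z ++ v.toList ∈ L := by
    refine hd _ (by rw [List.length_append]; omega) ?_
    rw [List.length_append]
    refine Nat.ModEq.add_right_cancel' w.toList.length ?_
    have hde : e ≡ 0 [MOD d] := (Nat.modEq_zero_iff_dvd).2 (hdn.mul_left _)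
    calc z.length + v.toList.length + w.toList.length
        = y.length + v.toList.length + e := by omega
      _ ≡ ℓ + w.toList.length + 0 [MOD d] := hmod.add hde
  have hzw : z ++ w.toList ∈ L := by
    simpa using (hvw (FreeMonoid.ofList z) 1).1 (by simpa using hzv)
  obtain ⟨d', hd'0, hd'n, hd'⟩ := hL _ hzw (by rw [List.length_append]; omega)
  refine hd' y hy ?_
  have hd'e : 0 ≡ e [MOD d'] :=
    ((Nat.modEq_zero_iff_dvd).2 ((Nat.dvd_factorial hd'0 hd'n).mul_left _)).symm
  have hlen : (z ++ w.toList).length = y.length + e := by rw [List.length_append]; omega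
  rw [hlen]
  exact hd'e.add_left y.length

/-- The generators: derivatives of `L` by words shorter than `N`, and saturated residue classes
modulo `1, …, n`. For simplicity each modulus is paired with all residues below `n`. -/
def generators (L : Language α) (N n : ℕ) : Fin N ⊕ Fin n × Fin n → Language α
  | .inl t => L.leftQuotient (List.replicate t default)
  | .inr (i, r) => congClass L (i + 1) r

theorem congClass_mem_joins (L : Language α) (N : ℕ) {n d r : ℕ} (hd : 0 < d) (hdn : d ≤ n)
    (hr : r < d) : congClass L d r ∈ joins (generators L N n) := by
  obtain ⟨e, rfl⟩ : ∃ e, d = e + 1 := ⟨d - 1, by omega⟩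
  exact mem_joins (generators L N n) (.inr (⟨e, hdn⟩, ⟨r, by omega⟩))

theorem leftQuotient_mem_joins_generators {L : Language α} {N n : ℕ}
    (hL : ∀ x ∈ L, N ≤ x.length → ∃ d, 0 < d ∧ d ≤ n ∧
      ∀ y : List α, N ≤ y.length → y.length ≡ x.length [MOD d] → y ∈ L) (w : List α) :
    L.leftQuotient w ∈ joins (generators L N n) := by
  classical
  rcases lt_or_ge w.length N with hw | hw
  · have : w = List.replicate w.length default := eq_of_length_eq (List.length_replicate ..).symm
    rw [this]
    exact mem_joins (generators L N n) (.inl ⟨w.length, hw⟩)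
  -- A derivative by a long word is the union of all generators that it contains.
  refine ⟨Finset.univ.filter fun i => generators L N n i ≤ L.leftQuotient w,
    le_antisymm (fun u hu => ?_) (Finset.sup_le fun i hi => (Finset.mem_filter.1 hi).2)⟩
  obtain ⟨d, hd, hdn, hcl⟩ := hL (w ++ u) hu (by rw [List.length_append]; omega)
  have hle : congClass L d (u.length % d) ≤ L.leftQuotient w := by
    rintro y ⟨v, v', hv, hmod⟩
    refine mem_of_mem_congClass hL hcl (Nat.dvd_factorial hd hdn)
      (by rw [List.length_append]; omega) ⟨v, v', hv, ?_⟩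
    rw [List.length_append, List.length_append, add_assoc, add_assoc]
    exact (hmod.trans ((Nat.mod_modEq _ _).add_right _)).add_left _
  have humem : u ∈ congClass L d (u.length % d) :=
    ⟨1, 1, (syntacticCon L).refl 1, (Nat.mod_modEq _ _).symm.add_right _⟩
  have hr : u.length % d < d := Nat.mod_lt _ hd
  obtain ⟨e, rfl⟩ : ∃ e, d = e + 1 := ⟨d - 1, by omega⟩
  have hmem : generators L N n (.inr (⟨e, hdn⟩, ⟨u.length % (e + 1), by omega⟩)) ≤
      L.leftQuotient w := hle
  have hi := Finset.le_sup (f := generators L N n)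
    ((Finset.mem_filter (p := fun i => generators L N n i ≤ L.leftQuotient w)).2
      ⟨Finset.mem_univ _, hmem⟩)
  exact hi humem

theorem nsyn_le_of_modulus {L : Language α} {N n : ℕ}
    (hL : ∀ x ∈ L, N ≤ x.length → ∃ d, 0 < d ∧ d ≤ n ∧
      ∀ y : List α, N ≤ y.length → y.length ≡ x.length [MOD d] → y ∈ L) :
    nsyn L ≤ N + n * n := by
  have key := nsyn_le_card L (generators L N n)
    (leftQuotient_mem_joins_generators hL []) ?_ ?_
  · simpa using key
  · rintro (t | ⟨i, r⟩) w
    · change (L.leftQuotient _).leftQuotient w ∈ _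
      rw [← Language.leftQuotient_append]
      exact leftQuotient_mem_joins_generators hL _
    · obtain ⟨r', hr', h⟩ := leftQuotient_congClass L i.1.succ_pos r w
      change (congClass L (i + 1) r).leftQuotient w ∈ _
      rw [h]
      exact congClass_mem_joins L N i.1.succ_pos i.2 hr'
  · rintro (t | ⟨i, r⟩) v w h
    · change (L.leftQuotient _).leftQuotient _ = (L.leftQuotient _).leftQuotient _
      rw [← Language.leftQuotient_append, ← Language.leftQuotient_append]
      exact leftQuotient_congr L
        ((syntacticCon L).mul ((syntacticCon L).refl (FreeMonoid.ofList _)) h)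
    · exact leftQuotient_congClass_congr L _ _ h

end Unary

end NSyn

theorem mainTheorem5 :
    ∃ C : ℕ, ∀ (α : Type u) [Unique α] (L : Language α), L.IsRegular →
      NSyn.nsyn L ≤ C * NSyn.ns L ^ 2 := by
  refine ⟨3, fun α _ L hreg => ?_⟩
  obtain ⟨σ, _, M, rfl, hcard⟩ := NSyn.ns_mem_nfaSizes hreg
  rw [← hcard]
  refine (NSyn.nsyn_le_of_modulus fun x hx hlen =>
    NSyn.exists_modulus_of_mem_accepts M hx hlen).trans (le_of_eq ?_)
  ring
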